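/- A weight sequence is a sequence $(M_n)_{n\ge 0}$ of positive real numbers with $M_0=1$ and $\dfrac{M_{n+m}}{M_nM_m}\ge\dbinom{n+m}{m}$ for all integers $n,m\ge 0$. For a compact interval $X\subset\mathbb{R}$ of positive length let $$D(X,M)=\Big\{f\in C^\infty(X;\mathbb{C}) : \|f\|_D=\sum_{n=0}^\infty \frac{\|f^{(n)}\|_\infty}{M_n}<\infty\Big\},$$ an algebra under pointwise operations with norm $\|\cdot\|_D$ (derivatives at the end points of $X$ are one-sided, and $\|\cdot\|_\infty$ is the supremum over $X$). A map $\varphi:X\to X$ induces an endomorphism of $D(X,M)$ if $f\circ\varphi\in D(X,M)$ for every $f\in D(X,M)$; the endomorphism is then $f\mapsto f\circ\varphi$. **Theorem 1.1.** Let $X$ be a compact interval of positive length and let $(M_n)$ be a weight sequence. Suppose that $\varphi:X\to X$ induces an endomorphism of $D(X,M)$ which is a compact operator, and let $x_0\in X$ be a fixed point of $\varphi$. Then $\varphi$ is differentiable at $x_0$ and $|\varphi'(x_0)|<1$. -/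

import Mathlib

/-- A weight sequence: positive reals with `M 0 = 1` and
`M (n + m) / (M n * M m) ≥ (n + m).choose m` for all `n`, `m`. -/
structure WeightSequence where
  M : ℕ → ℝ
  pos : ∀ n, 0 < M n
  zero : M 0 = 1
  choose_le : ∀ n m, ((n + m).choose m : ℝ) ≤ M (n + m) / (M n * M m)

namespace WeightedSmooth

open Set (Icc IccExtend)
open scoped ContDiff

variable {a b : ℝ}

/-- The `n`-th derivative of a complex function on `X = [a, b]` (one-sided at the end points).
`IccExtend` only serves to view `f` as a function on `ℝ`: derivatives are taken within `[a, b]`. -/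
noncomputable def derivX (hab : a < b) (n : ℕ) (f : Icc a b → ℂ) (x : Icc a b) : ℂ :=
  iteratedDerivWithin n (IccExtend hab.le f) (Icc a b) x

/-- The uniform norm of the `n`-th derivative over `[a, b]`. -/
noncomputable def supDeriv (hab : a < b) (n : ℕ) (f : Icc a b → ℂ) : ℝ :=
  ⨆ x : Icc a b, ‖derivX hab n f x‖

/-- `f` is infinitely differentiable on `[a, b]`. -/
def Smooth (hab : a < b) (f : Icc a b → ℂ) : Prop :=
  ContDiffOn ℝ ∞ (IccExtend hab.le f) (Icc a b)

/-- Membership in `D(X, M)`: `f` is smooth on `X = [a, b]` and `∑ ‖f⁽ⁿ⁾‖_∞ / M n < ∞`. -/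
def MemD (hab : a < b) (W : WeightSequence) (f : Icc a b → ℂ) : Prop :=
  Smooth hab f ∧ Summable fun n => supDeriv hab n f / W.M n

/-- The norm `∑ ‖f⁽ⁿ⁾‖_∞ / M n`. -/
noncomputable def normD (hab : a < b) (W : WeightSequence) (f : Icc a b → ℂ) : ℝ :=
  ∑' n, supDeriv hab n f / W.M n

section aux

variable (hab : a < b) (W : WeightSequence) {f g : Icc a b → ℂ}

theorem Smooth.within (hf : Smooth hab f) (n : ℕ) (x : Icc a b) :
    ContDiffWithinAt ℝ n (IccExtend hab.le f) (Icc a b) x :=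
  (hf x x.2).of_le (by exact_mod_cast le_top)

theorem supDeriv_nonneg (n : ℕ) (f : Icc a b → ℂ) : 0 ≤ supDeriv hab n f :=
  Real.iSup_nonneg fun _ => norm_nonneg _

theorem term_nonneg (n : ℕ) (f : Icc a b → ℂ) : 0 ≤ supDeriv hab n f / W.M n :=
  div_nonneg (supDeriv_nonneg hab n f) (W.pos n).le

theorem le_supDeriv (hf : Smooth hab f) (n : ℕ) (x : Icc a b) :
    ‖derivX hab n f x‖ ≤ supDeriv hab n f := by
  have hc : ContinuousOn (iteratedDerivWithin n (IccExtend hab.le f) (Icc a b)) (Icc a b) :=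
    ContDiffOn.continuousOn_iteratedDerivWithin hf (by exact_mod_cast le_top)
      (uniqueDiffOn_Icc hab)
  obtain ⟨C, hC⟩ := isCompact_Icc.exists_bound_of_continuousOn hc
  refine le_ciSup (f := fun x : Icc a b => ‖derivX hab n f x‖) ⟨C, ?_⟩ x
  rintro _ ⟨y, rfl⟩
  exact hC y y.2

theorem supDeriv_le {n : ℕ} {C : ℝ} (h : ∀ x, ‖derivX hab n f x‖ ≤ C) :
    supDeriv hab n f ≤ C := by
  have : Nonempty (Icc a b) := ⟨⟨a, Set.left_mem_Icc.2 hab.le⟩⟩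
  exact ciSup_le h

theorem supDeriv_add_le (hf : Smooth hab f) (hg : Smooth hab g) (n : ℕ) :
    supDeriv hab n (f + g) ≤ supDeriv hab n f + supDeriv hab n g := by
  refine supDeriv_le hab fun x => ?_
  have : derivX hab n (f + g) x = derivX hab n f x + derivX hab n g x :=
    iteratedDerivWithin_add x.2 (uniqueDiffOn_Icc hab) (hf.within hab n x) (hg.within hab n x)
  rw [this]
  exact (norm_add_le _ _).trans (add_le_add (le_supDeriv hab hf n x) (le_supDeriv hab hg n x))

theorem supDeriv_smul (c : ℂ) (f : Icc a b → ℂ) (n : ℕ) :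
    supDeriv hab n (c • f) = ‖c‖ * supDeriv hab n f := by
  have : ∀ x, ‖derivX hab n (c • f) x‖ = ‖c‖ * ‖derivX hab n f x‖ := fun x => by
    rw [← norm_mul]
    exact congrArg norm
      (iteratedDerivWithin_const_smul_field (s := Icc a b) (x := (x : ℝ)) c (IccExtend hab.le f))
  simp only [supDeriv, this]
  rw [Real.mul_iSup_of_nonneg (norm_nonneg c)]

theorem supDeriv_mul_le (hf : Smooth hab f) (hg : Smooth hab g) (n : ℕ) :
    supDeriv hab n (f * g) ≤ ∑ p ∈ Finset.HasAntidiagonal.antidiagonal n,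
      (n.choose p.1 : ℝ) * (supDeriv hab p.1 f * supDeriv hab p.2 g) := by
  refine supDeriv_le hab fun x => ?_
  have h : derivX hab n (f * g) x = ∑ i ∈ Finset.range (n + 1),
      (n.choose i : ℂ) * derivX hab i f x * derivX hab (n - i) g x :=
    iteratedDerivWithin_mul x.2 (uniqueDiffOn_Icc hab) (hf.within hab n x) (hg.within hab n x)
  rw [h, Finset.Nat.sum_antidiagonal_eq_sum_range_succ_mk]
  refine (norm_sum_le _ _).trans (Finset.sum_le_sum fun i _ => ?_)
  rw [norm_mul, norm_mul, Complex.norm_natCast, mul_assoc]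
  gcongr
  · exact supDeriv_nonneg hab _ _
  · exact le_supDeriv hab hf _ x
  · exact le_supDeriv hab hg _ x

theorem term_mul_le (hf : Smooth hab f) (hg : Smooth hab g) (n : ℕ) :
    supDeriv hab n (f * g) / W.M n ≤ ∑ p ∈ Finset.HasAntidiagonal.antidiagonal n,
      (supDeriv hab p.1 f / W.M p.1) * (supDeriv hab p.2 g / W.M p.2) := by
  rw [div_le_iff₀ (W.pos n), Finset.sum_mul]
  refine (supDeriv_mul_le hab hf hg n).trans (Finset.sum_le_sum fun p hp => ?_)
  have hn : p.2 + p.1 = n := by rw [add_comm]; exact Finset.HasAntidiagonal.mem_antidiagonal.1 hp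
  have h := W.choose_le p.2 p.1
  rw [hn, le_div_iff₀ (mul_pos (W.pos _) (W.pos _))] at h
  have h1 := W.pos p.1
  have h2 := W.pos p.2
  have h0 : 0 ≤ (supDeriv hab p.1 f / W.M p.1) * (supDeriv hab p.2 g / W.M p.2) :=
    mul_nonneg (term_nonneg hab W _ _) (term_nonneg hab W _ _)
  calc (n.choose p.1 : ℝ) * (supDeriv hab p.1 f * supDeriv hab p.2 g)
      = (supDeriv hab p.1 f / W.M p.1) * (supDeriv hab p.2 g / W.M p.2)
        * (n.choose p.1 * (W.M p.2 * W.M p.1)) := by field_simp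
    _ ≤ _ := mul_le_mul_of_nonneg_left h h0

theorem MemD.add (hf : MemD hab W f) (hg : MemD hab W g) : MemD hab W (f + g) := by
  refine ⟨ContDiffOn.add hf.1 hg.1,
    (hf.2.add hg.2).of_nonneg_of_le (term_nonneg hab W · _) fun n => ?_⟩
  rw [← add_div]
  exact div_le_div_of_nonneg_right (supDeriv_add_le hab hf.1 hg.1 n) (W.pos n).le

theorem summable_prod (hf : MemD hab W f) (hg : MemD hab W g) :
    Summable fun n => ∑ p ∈ Finset.HasAntidiagonal.antidiagonal n,
      (supDeriv hab p.1 f / W.M p.1) * (supDeriv hab p.2 g / W.M p.2) :=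
  summable_sum_mul_antidiagonal_of_summable_mul (f := fun n => supDeriv hab n f / W.M n)
    (g := fun n => supDeriv hab n g / W.M n)
    (Summable.mul_of_nonneg hf.2 hg.2 (fun n => term_nonneg hab W n f)
      (fun n => term_nonneg hab W n g))

theorem MemD.mul (hf : MemD hab W f) (hg : MemD hab W g) : MemD hab W (f * g) :=
  ⟨ContDiffOn.mul hf.1 hg.1, (summable_prod hab W hf hg).of_nonneg_of_le
    (term_nonneg hab W · _) (term_mul_le hab W hf.1 hg.1)⟩

theorem memD_const (c : ℂ) : MemD hab W (fun _ => c) := by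
  have hE : IccExtend hab.le (fun _ : Icc a b => c) = fun _ => c := rfl
  refine ⟨by rw [Smooth, hE]; exact contDiffOn_const,
    summable_of_ne_finset_zero (s := {0}) fun n hn => ?_⟩
  have hn0 : n ≠ 0 := by simpa using hn
  have : supDeriv hab n (fun _ : Icc a b => c) = 0 := by
    simp [supDeriv, derivX, hE, iteratedDerivWithin_const, hn0]
  rw [this, zero_div]

end aux

/-- `D(X, M)` as a subalgebra of the algebra of all functions `X → ℂ`
(pointwise operations). -/
def subalg (hab : a < b) (W : WeightSequence) : Subalgebra ℂ (Icc a b → ℂ) where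
  carrier := {f | MemD hab W f}
  mul_mem' := MemD.mul hab W
  add_mem' := MemD.add hab W
  algebraMap_mem' := memD_const hab W

/-- The algebra `D(X, M)`, `X = [a, b]`. It is a separate type so that it carries the topology of
its own norm and not the topology of pointwise convergence. -/
def D (hab : a < b) (W : WeightSequence) : Type := subalg hab W

section alg

variable (hab : a < b) (W : WeightSequence)

noncomputable instance : CommRing (D hab W) := inferInstanceAs (CommRing (subalg hab W))

noncomputable instance : Algebra ℂ (D hab W) := inferInstanceAs (Algebra ℂ (subalg hab W))

/-- The underlying function on `[a, b]` of an element of `D(X, M)`. -/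
def D.fn {hab : a < b} {W : WeightSequence} (f : D hab W) : Icc a b → ℂ := f.1

theorem normD_nonneg (f : Icc a b → ℂ) : 0 ≤ normD hab W f :=
  tsum_nonneg (term_nonneg hab W · f)

theorem normD_smul (c : ℂ) (f : Icc a b → ℂ) : normD hab W (c • f) = ‖c‖ * normD hab W f := by
  simp only [normD, supDeriv_smul, mul_div_assoc, tsum_mul_left]

/-- `∑ ‖f⁽ⁿ⁾‖_∞ / M n` is an algebra norm on `D(X, M)`. -/
noncomputable def ringNorm : RingNorm (D hab W) where
  toFun f := normD hab W f.fn
  map_zero' := by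
    have h := normD_smul hab W 0 (0 : Icc a b → ℂ)
    rw [smul_zero, norm_zero, zero_mul] at h
    exact h
  add_le' f g := by
    have hf : MemD hab W f.fn := f.2
    have hg : MemD hab W g.fn := g.2
    change normD hab W (f.fn + g.fn) ≤ _
    unfold normD
    rw [← hf.2.tsum_add hg.2]
    refine (hf.add hab W hg).2.tsum_le_tsum (fun n => ?_) (hf.2.add hg.2)
    rw [← add_div]
    exact div_le_div_of_nonneg_right (supDeriv_add_le hab hf.1 hg.1 n) (W.pos n).le
  neg' f := by
    have h := normD_smul hab W (-1) f.fn
    rw [norm_neg, norm_one, one_mul, neg_one_smul] at h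
    exact h
  mul_le' f g := by
    have hf : MemD hab W f.fn := f.2
    have hg : MemD hab W g.fn := g.2
    change normD hab W (f.fn * g.fn) ≤ normD hab W f.fn * normD hab W g.fn
    unfold normD
    rw [hf.2.tsum_mul_tsum_eq_tsum_sum_antidiagonal hg.2
      (hf.2.mul_of_nonneg hg.2 (term_nonneg hab W · f.fn) (term_nonneg hab W · g.fn))]
    exact (hf.mul hab W hg).2.tsum_le_tsum (term_mul_le hab W hf.1 hg.1)
      (summable_prod hab W hf hg)
  eq_zero_of_map_eq_zero' f h := by
    have hf : MemD hab W f.fn := f.2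
    have h0 : supDeriv hab 0 f.fn / W.M 0 ≤ normD hab W f.fn :=
      hf.2.le_tsum 0 fun n _ => term_nonneg hab W n _
    rw [W.zero, div_one] at h0
    apply Subtype.ext
    funext x
    have hx := (le_supDeriv hab hf.1 0 x).trans (h0.trans h.le)
    have hx0 : derivX hab 0 f.fn x = f.fn x := by
      simp [derivX]
    rw [hx0] at hx
    exact norm_le_zero_iff.1 hx

noncomputable instance : NormedCommRing (D hab W) :=
  { (ringNorm hab W).toNormedRing with mul_comm := mul_comm }

theorem norm_def (f : D hab W) : ‖f‖ = ∑' n, supDeriv hab n f.fn / W.M n := rfl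

noncomputable instance : NormedAlgebra ℂ (D hab W) where
  norm_smul_le c f := (normD_smul hab W c f.fn).le

/-- A self-map `φ` of `X` induces an endomorphism of `D(X, M)`: `f ∘ φ ∈ D(X, M)` whenever
`f ∈ D(X, M)`. -/
def InducesEnd (φ : Icc a b → Icc a b) : Prop :=
  ∀ f : Icc a b → ℂ, MemD hab W f → MemD hab W (f ∘ φ)

/-- The endomorphism `f ↦ f ∘ φ` of the algebra `D(X, M)`. -/
noncomputable def inducedEnd {φ : Icc a b → Icc a b} (hφ : InducesEnd hab W φ) :
    D hab W →ₐ[ℂ] D hab W where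
  toFun f := ⟨f.fn ∘ φ, hφ f.fn f.2⟩
  map_one' := rfl
  map_mul' _ _ := rfl
  map_zero' := rfl
  map_add' _ _ := rfl
  commutes' _ := rfl

end alg

end WeightedSmooth

/-! The endomorphism `T f = f ∘ φ` preserves the subspace of functions vanishing to order `n` at
the fixed point `x₀`. By the leading term of Faà di Bruno's formula, `T` acts on the `n`-th quotient
of this strictly decreasing filtration as multiplication by `φ'(x₀) ^ n`. Riesz's lemma in the
successive quotients shows that the scalars obtained in this way from a compact operator tend to
`0`. Hence `φ'(x₀) ^ n → 0`, that is, `|φ'(x₀)| < 1`. -/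

section CompactOperator

open Filter Topology

variable {𝕜 E : Type*} [NontriviallyNormedField 𝕜] [NormedAddCommGroup E] [NormedSpace 𝕜 E]

theorem exists_norm_le_forall_one_le_norm_sub {c : 𝕜} (hc : 1 < ‖c‖) {R : ℝ} (hR : ‖c‖ < R)
    {p q : Submodule 𝕜 E} (hp : IsClosed (p : Set E)) (hpq : p < q) :
    ∃ x ∈ q, ‖x‖ ≤ R ∧ ∀ y ∈ p, 1 ≤ ‖x - y‖ := by
  obtain ⟨z, hzq, hzp⟩ := SetLike.exists_of_lt hpq
  have hclosed : IsClosed (p.comap q.subtype : Set q) := hp.preimage continuous_subtype_val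
  obtain ⟨x, hxR, hx⟩ := riesz_lemma_of_norm_lt hc hR hclosed ⟨⟨z, hzq⟩, hzp⟩
  exact ⟨x, x.2, hxR, fun y hy => hx ⟨y, hpq.le hy⟩ hy⟩

theorem norm_le_dist_map_of_forall_one_le_norm_sub {T : E →ₗ[𝕜] E} {p : Submodule 𝕜 E} {μ : 𝕜}
    {x y : E} (hx : T x - μ • x ∈ p) (hxp : ∀ z ∈ p, 1 ≤ ‖x - z‖) (hy : T y ∈ p) :
    ‖μ‖ ≤ dist (T x) (T y) := by
  rcases eq_or_ne μ 0 with rfl | hμ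
  · simp
  have hz : -μ⁻¹ • (T x - μ • x - T y) ∈ p := p.smul_mem _ (p.sub_mem hx hy)
  have heq : T x - T y = μ • (x - -μ⁻¹ • (T x - μ • x - T y)) := by
    rw [smul_sub, smul_smul, mul_neg, mul_inv_cancel₀ hμ, neg_one_smul]
    abel
  rw [dist_eq_norm, heq, norm_smul]
  exact le_mul_of_one_le_right (norm_nonneg μ) (hxp _ hz)

theorem tendsto_zero_of_isCompactOperator_of_strictAnti {T : E →ₗ[𝕜] E}
    (hT : IsCompactOperator T) {V : ℕ → Submodule 𝕜 E} (hV : StrictAnti V)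
    (hclosed : ∀ n, IsClosed (V n : Set E)) {μ : ℕ → 𝕜}
    (hμ : ∀ n, ∀ x ∈ V n, T x - μ n • x ∈ V (n + 1)) : Tendsto μ atTop (𝓝 0) := by
  obtain ⟨c, hc⟩ := NormedField.exists_one_lt_norm 𝕜
  choose x hxV hxR hx using fun n =>
    exists_norm_le_forall_one_le_norm_sub hc (lt_add_one ‖c‖) (hclosed (n + 1))
      (hV n.lt_succ_self)
  have hTV : ∀ n, T (x n) ∈ V n := fun n =>
    by
    simpa using add_mem (hV.antitone n.le_succ (hμ n _ (hxV n))) ((V n).smul_mem (μ n) (hxV n))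
  have hsep : ∀ m n, m < n → ‖μ m‖ ≤ dist (T (x m)) (T (x n)) := fun m n hmn =>
    norm_le_dist_map_of_forall_one_le_norm_sub (hμ m _ (hxV m)) (hx m) (hV.antitone hmn (hTV n))
  obtain ⟨K, hK, hTK⟩ := hT.image_closedBall_subset_compact (‖c‖ + 1)
  refine tendsto_of_subseq_tendsto fun ns hns => ?_
  obtain ⟨y, -, ms, hms, hy⟩ := hK.tendsto_subseq (x := fun k => T (x (ns k)))
    fun k => hTK ⟨x (ns k), mem_closedBall_zero_iff.2 (hxR _), rfl⟩
  have hle : ∀ k, ‖μ (ns (ms k))‖ ≤ dist (T (x (ns (ms k)))) y := fun k =>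
    ge_of_tendsto (tendsto_const_nhds.dist hy) <|
      ((hns.comp hms.tendsto_atTop).eventually_gt_atTop (ns (ms k))).mono fun j hj => hsep _ _ hj
  exact ⟨ms, squeeze_zero_norm hle (tendsto_iff_dist_tendsto_zero.1 hy)⟩

end CompactOperator

section IteratedDeriv

open Polynomial

theorem orderedFinpartition_eq_atomic {n : ℕ} {c : OrderedFinpartition n} (hc : c.length = n) :
    c = OrderedFinpartition.atomic n := by
  obtain ⟨l, size, size_pos, emb, emb_mono, last_mono, disj, _⟩ := c
  obtain rfl : l = n := hc
  have hlast : ∀ m, emb m ⟨size m - 1, Nat.sub_one_lt_of_lt (size_pos m)⟩ = m :=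
    congrFun last_mono.eq_id
  -- The value `emb m i` is also the greatest element of the part with index `emb m i`.
  have hemb : ∀ m i, emb m i = m := fun m i => by
    by_contra hne
    exact (disj trivial trivial hne).ne_of_mem ⟨_, hlast (emb m i)⟩ ⟨i, rfl⟩ rfl
  have hsize : size = fun _ => 1 := funext fun m => by
    have hsub : Subsingleton (Fin (size m)) :=
      ⟨fun i j => (emb_mono m).injective ((hemb m i).trans (hemb m j).symm)⟩
    exact (Fin.subsingleton_iff_le_one.1 hsub).antisymm (size_pos m)
  subst hsize
  simp only [OrderedFinpartition.atomic, funext₂ hemb]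

theorem iteratedDerivWithin_scomp_of_forall_lt_eq_zero {𝕜 E : Type*} [NontriviallyNormedField 𝕜]
    [NormedAddCommGroup E] [NormedSpace 𝕜 E] {g : 𝕜 → E} {f : 𝕜 → 𝕜} {s t : Set 𝕜} {x : 𝕜} {n : ℕ}
    (hg : ContDiffWithinAt 𝕜 n g t (f x)) (hf : ContDiffWithinAt 𝕜 n f s x)
    (ht : UniqueDiffOn 𝕜 t) (hs : UniqueDiffOn 𝕜 s) (hx : x ∈ s) (hst : Set.MapsTo f s t)
    (hzero : ∀ k < n, iteratedDerivWithin k g t (f x) = 0) :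
    iteratedDerivWithin n (g ∘ f) s x
      = derivWithin f s x ^ n • iteratedDerivWithin n g t (f x) := by
  rw [iteratedDerivWithin_scomp_eq_sum_orderedFinpartition hg hf ht hs hx hst le_rfl,
    Finset.sum_eq_single (OrderedFinpartition.atomic n)]
  · simp
  · intro c _ hc
    rw [hzero c.length (c.length_le.lt_of_ne (mt orderedFinpartition_eq_atomic hc)), smul_zero]
  · simp

theorem iteratedDerivWithin_eval_ofReal {s : Set ℝ} (hs : UniqueDiffOn ℝ s) (q : ℂ[X]) (k : ℕ)
    {x : ℝ} (hx : x ∈ s) :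
    iteratedDerivWithin k (fun y : ℝ => q.eval (y : ℂ)) s x = (derivative^[k] q).eval (x : ℂ) := by
  induction k generalizing q with
  | zero => simp
  | succ k ih =>
    have hderiv : Set.EqOn (derivWithin (fun y : ℝ => q.eval (y : ℂ)) s)
        (fun y : ℝ => q.derivative.eval (y : ℂ)) s := fun y hy =>
      (q.hasDerivAt (y : ℂ)).comp_ofReal.hasDerivWithinAt.derivWithin (hs y hy)
    rw [iteratedDerivWithin_succ', iteratedDerivWithin_congr hderiv hx, ih,
      Function.iterate_succ_apply]

end IteratedDeriv

namespace WeightedSmooth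

open Set (Icc IccExtend)
open Polynomial
open scoped ContDiff

variable {a b : ℝ} {hab : a < b} {W : WeightSequence} {φ : Icc a b → Icc a b} {x : Icc a b} {n : ℕ}

variable (hab) in
theorem eqOn_iccExtend_eval (q : ℂ[X]) :
    Set.EqOn (IccExtend hab.le fun y : Icc a b => q.eval ((y : ℝ) : ℂ))
      (fun y : ℝ => q.eval (y : ℂ)) (Icc a b) :=
  fun _ hy => Set.IccExtend_of_mem _ _ hy

variable (hab) in
theorem derivX_eval (q : ℂ[X]) (n : ℕ) (x : Icc a b) :
    derivX hab n (fun y => q.eval ((y : ℝ) : ℂ)) x = (derivative^[n] q).eval ((x : ℝ) : ℂ) :=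
  (iteratedDerivWithin_congr (eqOn_iccExtend_eval hab q) x.2).trans
    (iteratedDerivWithin_eval_ofReal (uniqueDiffOn_Icc hab) q n x.2)

variable (hab W) in
theorem memD_eval (q : ℂ[X]) : MemD hab W fun y : Icc a b => q.eval ((y : ℝ) : ℂ) := by
  have hsmooth : ContDiff ℝ ∞ fun y : ℝ => q.eval (y : ℂ) :=
    (q.differentiable.contDiff.restrict_scalars ℝ).comp Complex.ofRealCLM.contDiff
  refine ⟨hsmooth.contDiffOn.congr (eqOn_iccExtend_eval hab q),
    summable_of_ne_finset_zero (s := Finset.range (q.natDegree + 1)) fun n hn => ?_⟩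
  have hderiv : derivative^[n] q = 0 := iterate_derivative_eq_zero (by simpa using hn)
  simp [supDeriv, derivX_eval, hderiv]

theorem InducesEnd.contDiffOn (hφ : InducesEnd hab W φ) :
    ContDiffOn ℝ ∞ (IccExtend hab.le fun y => (φ y : ℝ)) (Icc a b) := by
  have hcoord : MemD hab W fun y => ((φ y : ℝ) : ℂ) := by
    simpa [Function.comp_def] using hφ _ (memD_eval hab W X)
  exact Complex.reCLM.contDiff.comp_contDiffOn hcoord.1

theorem derivX_comp_of_forall_lt_eq_zero
    (hφ : ContDiffOn ℝ ∞ (IccExtend hab.le fun y => (φ y : ℝ)) (Icc a b)) {f : Icc a b → ℂ}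
    (hf : Smooth hab f) (hzero : ∀ k < n, derivX hab k f (φ x) = 0) :
    derivX hab n (f ∘ φ) x
      = derivWithin (IccExtend hab.le fun y => (φ y : ℝ)) (Icc a b) x ^ n
        • derivX hab n f (φ x) := by
  have hcomp : IccExtend hab.le (f ∘ φ)
      = IccExtend hab.le f ∘ IccExtend hab.le fun y => (φ y : ℝ) := by
    funext y
    simp [IccExtend]
  have hφx : IccExtend hab.le (fun y => (φ y : ℝ)) x = φ x := Set.IccExtend_val ..
  unfold derivX at hzero ⊢
  rw [hcomp, ← hφx]
  rw [← hφx] at hzero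
  refine iteratedDerivWithin_scomp_of_forall_lt_eq_zero ?_
    ((hφ x x.2).of_le (by exact_mod_cast le_top)) (uniqueDiffOn_Icc hab) (uniqueDiffOn_Icc hab) x.2
    (fun _ _ => Subtype.coe_prop _) hzero
  rw [hφx]
  exact hf.within hab n (φ x)

theorem norm_derivX_le (f : D hab W) (n : ℕ) (x : Icc a b) :
    ‖derivX hab n f.fn x‖ ≤ W.M n * ‖f‖ := by
  have hterm : supDeriv hab n f.fn / W.M n ≤ ‖f‖ :=
    f.2.2.le_tsum n fun k _ => term_nonneg hab W k _
  exact (le_supDeriv hab f.2.1 n x).trans ((div_le_iff₀' (W.pos n)).1 hterm)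

variable (hab W) in
/-- The functional `f ↦ f⁽ⁿ⁾(x)` on `D(X, M)`. -/
noncomputable def evalDeriv (n : ℕ) (x : Icc a b) : D hab W →L[ℂ] ℂ :=
  LinearMap.mkContinuous
    { toFun := fun f => derivX hab n f.fn x
      map_add' := fun f g => iteratedDerivWithin_add x.2 (uniqueDiffOn_Icc hab)
        (Smooth.within hab f.2.1 n x) (Smooth.within hab g.2.1 n x)
      map_smul' := fun c f =>
        iteratedDerivWithin_const_smul_field (s := Icc a b) c (IccExtend hab.le f.fn) }
    (W.M n) (norm_derivX_le · n x)

variable (hab W) in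
/-- The subspace of those functions in `D(X, M)` that vanish to order `n` at `x`, meaning that
their derivatives of order less than `n` are zero there. -/
noncomputable def vanishing (x : Icc a b) (n : ℕ) : Submodule ℂ (D hab W) :=
  ⨅ k < n, (evalDeriv hab W k x).ker

theorem mem_vanishing {f : D hab W} :
    f ∈ vanishing hab W x n ↔ ∀ k < n, evalDeriv hab W k x f = 0 := by
  simp only [vanishing, Submodule.mem_iInf, LinearMap.mem_ker, ContinuousLinearMap.coe_coe]

theorem isClosed_vanishing (x : Icc a b) (n : ℕ) :
    IsClosed (vanishing hab W x n : Set (D hab W)) := by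
  simp only [vanishing, Submodule.coe_iInf]
  exact isClosed_iInter fun k => isClosed_iInter fun _ => (evalDeriv hab W k x).isClosed_ker

theorem antitone_vanishing (x : Icc a b) : Antitone (vanishing hab W x) :=
  fun _ _ hmn _ hf => mem_vanishing.2 fun k hk => mem_vanishing.1 hf k (hk.trans_le hmn)

variable (hab W) in
theorem exists_mem_vanishing_notMem_succ (x : Icc a b) (n : ℕ) :
    ∃ f ∈ vanishing hab W x n, f ∉ vanishing hab W x (n + 1) := by
  let q : ℂ[X] := (X - C ((x : ℝ) : ℂ)) ^ n
  have hderiv : ∀ k, evalDeriv hab W k x ⟨_, memD_eval hab W q⟩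
      = (derivative^[k] q).eval ((x : ℝ) : ℂ) := fun k => derivX_eval hab q k x
  refine ⟨⟨_, memD_eval hab W q⟩, mem_vanishing.2 fun k hk => ?_, fun hmem => ?_⟩
  · have hne : n - k ≠ 0 := (Nat.sub_pos_of_lt hk).ne'
    rw [hderiv]
    simp [q, iterate_derivative_X_sub_pow, hne]
  · have hzero : (derivative^[n] q).eval ((x : ℝ) : ℂ) = 0 :=
      (hderiv n).symm.trans (mem_vanishing.1 hmem n n.lt_succ_self)
    simp [q, iterate_derivative_X_sub_pow_self, n.factorial_ne_zero] at hzero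

theorem strictAnti_vanishing (x : Icc a b) : StrictAnti (vanishing hab W x) :=
  strictAnti_nat_of_succ_lt fun n =>
    SetLike.lt_iff_le_and_exists.2
      ⟨antitone_vanishing x n.le_succ, exists_mem_vanishing_notMem_succ hab W x n⟩

theorem evalDeriv_inducedEnd (hφ : InducesEnd hab W φ) (hx : φ x = x) {f : D hab W}
    (hf : f ∈ vanishing hab W x n) :
    evalDeriv hab W n x (inducedEnd hab W hφ f)
      = ((derivWithin (IccExtend hab.le fun y => (φ y : ℝ)) (Icc a b) x : ℝ) : ℂ) ^ n
        * evalDeriv hab W n x f := by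
  have hcomp := derivX_comp_of_forall_lt_eq_zero (n := n) (x := x) hφ.contDiffOn f.2.1
    (by rw [hx]; exact mem_vanishing.1 hf)
  rw [hx, Complex.real_smul, Complex.ofReal_pow] at hcomp
  exact hcomp

theorem inducedEnd_sub_smul_mem_vanishing (hφ : InducesEnd hab W φ) (hx : φ x = x) {f : D hab W}
    (hf : f ∈ vanishing hab W x n) :
    inducedEnd hab W hφ f
        - ((derivWithin (IccExtend hab.le fun y => (φ y : ℝ)) (Icc a b) x : ℝ) : ℂ) ^ n • f
      ∈ vanishing hab W x (n + 1) := by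
  refine mem_vanishing.2 fun k hk => ?_
  have hkn : k ≤ n := Nat.lt_succ_iff.1 hk
  rw [map_sub, map_smul, smul_eq_mul, evalDeriv_inducedEnd hφ hx (antitone_vanishing x hkn hf)]
  rcases hkn.eq_or_lt with rfl | hlt
  · exact sub_self _
  · simp [mem_vanishing.1 hf k hlt]

end WeightedSmooth

open Filter Topology in
theorem theorem1p1 (a b : ℝ) (hab : a < b) (W : WeightSequence)
    (φ : Set.Icc a b → Set.Icc a b) (hφ : WeightedSmooth.InducesEnd hab W φ)
    (hcompact : IsCompactOperator (WeightedSmooth.inducedEnd hab W hφ))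
    (x₀ : Set.Icc a b) (hx₀ : φ x₀ = x₀) :
    DifferentiableWithinAt ℝ (Set.IccExtend hab.le fun x => (φ x : ℝ)) (Set.Icc a b) x₀ ∧
      |derivWithin (Set.IccExtend hab.le fun x => (φ x : ℝ)) (Set.Icc a b) x₀| < 1 := by
  refine ⟨hφ.contDiffOn.differentiableOn (by simp) x₀ x₀.2, ?_⟩
  have hpow : Tendsto (fun n => ((derivWithin (Set.IccExtend hab.le fun x => (φ x : ℝ))
      (Set.Icc a b) x₀ : ℝ) : ℂ) ^ n) atTop (𝓝 0) :=
    tendsto_zero_of_isCompactOperator_of_strictAnti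
      (T := (WeightedSmooth.inducedEnd hab W hφ).toLinearMap) hcompact
      (WeightedSmooth.strictAnti_vanishing x₀) (WeightedSmooth.isClosed_vanishing x₀)
      fun _ _ => WeightedSmooth.inducedEnd_sub_smul_mem_vanishing hφ hx₀
  simpa using tendsto_pow_atTop_nhds_zero_iff_norm_lt_one.1 hpow
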